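/- **Theorem.** The category of inverse semigroups and semigroup homomorphisms is equivalent to the category of self-supported categories, where the latter is defined as follows. (Composition is written from left to right.) A *category with subobjects* is a small category $\mathcal C$ with a subcategory $\mathcal P$ having the same objects, whose morphisms are called *inclusions*, such that: between any two objects there is at most one inclusion, and the only isomorphisms of $\mathcal P$ are identities; every inclusion is a monomorphism of $\mathcal C$; and if $f=hg$ with $f,g\in\mathcal P$ and $h\in\mathcal C$, then $h\in\mathcal P$. Write $c\preceq c'$ if there is an inclusion $j(c,c')\colon c\to c'$; this is a partial order on the set $v\mathcal C$ of objects. A *retraction* is a morphism $q\colon c'\to c$ with $j(c,c')q=1_c$ for some inclusion $j(c,c')$. A *cone* with vertex $z$ is a family of morphisms $\gamma(c)\colon c\to z$ ($c\in v\mathcal C$) with $j(a,b)\gamma(b)=\gamma(a)$ whenever $a\preceq b$, at least one of which is an isomorphism. The category $\mathcal C$ is *normal* if every inclusion splits (has a right inverse in $\mathcal C$), every morphism is of the form $quj$ with $q$ a retraction, $u$ an isomorphism and $j$ an inclusion, and for each object $c$ there is a cone $\mu$ with vertex $c$ and $\mu(c)=1_c$. Let $\mathcal C$ be normal. Every morphism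 $f$ factors uniquely as $f=f^\circ j$ with $f^\circ$ an epimorphism and $j$ an inclusion, and the set $\widehat{\mathcal C}$ of all cones in $\mathcal C$ is a regular semigroup under $(\gamma\cdot\delta)(c)=\gamma(c)\,(\delta(z_\gamma))^\circ$, where $z_\gamma$ is the vertex of $\gamma$. Put $\gamma\leqslant_r\delta$ if $\gamma\in\delta\,\widehat{\mathcal C}$; this quasi-order induces the equivalence $\mathscr R$ and the poset $(\widehat{\mathcal C}/\mathscr R,\sqsubseteq)$. An object $c$ is *connected by* $\mathfrak d\in\widehat{\mathcal C}/\mathscr R$ if $\mathfrak d$ contains an idempotent cone with vertex $c$; this cone is then unique and is denoted by $\epsilon(c,\mathfrak d)$. A *connected category* $\mathcal C_{\mathfrak D}$ is a normal category $\mathcal C$ together with a down-set $\mathfrak D$ of $\widehat{\mathcal C}/\mathscr R$ such that every object of $\mathcal C$ is connected by some $\mathfrak d\in\mathfrak D$. It is *supported* if every object $c$ is connected by a unique $\mathfrak d\in\mathfrak D$, which is then denoted by $\Gamma(c)$; the map $\Gamma\colon v\mathcal C\to\mathfrak D$ is the *support map*. A supported category is *self-supported* if $\Gamma$ is an order isomorphism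 from $(v\mathcal C,\preceq)$ onto $(\mathfrak D,\sqsubseteq)$. A morphism $\mathcal C_{\mathfrak D}\to\mathcal C'_{\mathfrak D'}$ of connected categories is a pair $(F,G)$, where $F\colon\mathcal C\to\mathcal C'$ is a functor that maps inclusions to inclusions and $G\colon\mathfrak D\to\mathfrak D'$ is an order preserving map, such that whenever $c\in v\mathcal C$ is connected by $\mathfrak d\in\mathfrak D$, the object $F(c)$ is connected by $G(\mathfrak d)$ and $F(\epsilon(c,\mathfrak d)(c'))=\epsilon(F(c),G(\mathfrak d))(F(c'))$ for all $c'\in v\mathcal C$. Self-supported categories form a full subcategory of the category of connected categories so obtained. -/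

import Mathlib

open CategoryTheory

universe v u

namespace ConeSemigroups

/-! ### Categories with subobjects and normal categories

Composition `f ≫ g` is written in the order "first `f`, then `g`". -/

/-- A category with subobjects: a wide subcategory `incl` of `C` (its morphisms are called
inclusions) which is a strict preorder, consists of monomorphisms of `C`, and is such that
`h ≫ g ∈ incl` and `g ∈ incl` imply `h ∈ incl`. -/
class CategoryWithSubobjects (C : Type u) [Category.{v} C] where
  /-- the inclusions -/
  incl : MorphismProperty C
  id_incl : ∀ X : C, incl (𝟙 X)
  comp_incl : ∀ {X Y Z : C} (f : X ⟶ Y) (g : Y ⟶ Z), incl f → incl g → incl (f ≫ g)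
  /-- there is at most one inclusion between two given objects -/
  incl_unique : ∀ {X Y : C} (f g : X ⟶ Y), incl f → incl g → f = g
  /-- the only isomorphisms of the subcategory of inclusions are the identities -/
  incl_strict : ∀ {X Y : C} (f : X ⟶ Y) (g : Y ⟶ X), incl f → incl g →
    f ≫ g = 𝟙 X → g ≫ f = 𝟙 Y → ∃ h : X = Y, f = eqToHom h
  mono_of_incl : ∀ {X Y : C} (f : X ⟶ Y), incl f → Mono f
  incl_of_comp : ∀ {X Y Z : C} (h : X ⟶ Y) (g : Y ⟶ Z), incl (h ≫ g) → incl g → incl h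

section Subobjects

variable {C : Type u} [Category.{v} C] [CategoryWithSubobjects C]

/-- `f` is an inclusion. -/
abbrev IsInclusion {X Y : C} (f : X ⟶ Y) : Prop := CategoryWithSubobjects.incl f

/-- The partial order `a ⪯ b` on the objects: there is an inclusion `a ⟶ b`. -/
def SubLE (a b : C) : Prop := ∃ j : a ⟶ b, IsInclusion j

/-- A retraction is a right inverse of some inclusion. -/
def IsRetr {X Y : C} (q : X ⟶ Y) : Prop := ∃ j : Y ⟶ X, IsInclusion j ∧ j ≫ q = 𝟙 Y

/-- `f = q u j` with `q` a retraction, `u` an isomorphism and `j` an inclusion. -/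
def HasNormalFactorisation {X Y : C} (f : X ⟶ Y) : Prop :=
  ∃ (A B : C) (q : X ⟶ A) (w : A ⟶ B) (j : B ⟶ Y),
    IsRetr q ∧ IsIso w ∧ IsInclusion j ∧ f = q ≫ w ≫ j

/-- Cones with vertex `z`: families `γ(c) : c ⟶ z`, compatible with the inclusions, such that at
least one component is an isomorphism. -/
@[ext]
structure ConeAt (z : C) where
  app : ∀ c : C, c ⟶ z
  incl_app : ∀ {a b : C} (j : a ⟶ b), IsInclusion j → j ≫ app b = app a
  exists_isIso : ∃ c : C, IsIso (app c)

end Subobjects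

/-- Normal categories. -/
class NormalCategory (C : Type u) [Category.{v} C] extends CategoryWithSubobjects C where
  /-- every inclusion splits -/
  split : ∀ {X Y : C} (j : X ⟶ Y), IsInclusion j → ∃ q : Y ⟶ X, j ≫ q = 𝟙 X
  normal_factorisation : ∀ {X Y : C} (f : X ⟶ Y), HasNormalFactorisation f
  exists_cone : ∀ c : C, ∃ μ : ConeAt c, μ.app c = 𝟙 c

section SubobjectFacts

variable {C : Type u} [Category.{v} C] [CategoryWithSubobjects C]

theorem eq_of_incl_incl {X Y : C} (f : X ⟶ Y) (g : Y ⟶ X) (hf : IsInclusion f)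
    (hg : IsInclusion g) : ∃ h : X = Y, f = eqToHom h :=
  CategoryWithSubobjects.incl_strict f g hf hg
    (CategoryWithSubobjects.incl_unique _ _ (CategoryWithSubobjects.comp_incl _ _ hf hg)
      (CategoryWithSubobjects.id_incl _))
    (CategoryWithSubobjects.incl_unique _ _ (CategoryWithSubobjects.comp_incl _ _ hg hf)
      (CategoryWithSubobjects.id_incl _))

theorem incl_eqToHom {X Y : C} (h : X = Y) : IsInclusion (eqToHom h) := by
  subst h
  exact CategoryWithSubobjects.id_incl _

/-- A retraction followed by an isomorphism has a one-sided inverse. -/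
theorem IsRetr.exists_section {X A B : C} {q : X ⟶ A} (hq : IsRetr q) (w : A ⟶ B) [IsIso w] :
    ∃ s : B ⟶ X, s ≫ q ≫ w = 𝟙 B := by
  obtain ⟨j, _, hj⟩ := hq
  refine ⟨inv w ≫ j, ?_⟩
  rw [Category.assoc, ← Category.assoc j, hj]
  simp

theorem eq_of_section {X Z Z' Y : C} (p : X ⟶ Z) (j : Z ⟶ Y) (p' : X ⟶ Z') (j' : Z' ⟶ Y)
    (hp : ∃ s : Z ⟶ X, s ≫ p = 𝟙 Z) (hp' : ∃ s : Z' ⟶ X, s ≫ p' = 𝟙 Z')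
    (hj : IsInclusion j) (hj' : IsInclusion j') (h : p ≫ j = p' ≫ j') :
    ∃ e : Z = Z', p ≫ eqToHom e = p' := by
  obtain ⟨s, hs⟩ := hp
  obtain ⟨s', hs'⟩ := hp'
  have h1 : (s ≫ p') ≫ j' = j := by
    rw [Category.assoc, ← h, ← Category.assoc, hs, Category.id_comp]
  have h2 : (s' ≫ p) ≫ j = j' := by
    rw [Category.assoc, h, ← Category.assoc, hs', Category.id_comp]
  have i1 : IsInclusion (s ≫ p') :=
    CategoryWithSubobjects.incl_of_comp _ j' (by rw [h1]; exact hj) hj'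
  have i2 : IsInclusion (s' ≫ p) :=
    CategoryWithSubobjects.incl_of_comp _ j (by rw [h2]; exact hj') hj
  obtain ⟨e, he⟩ := eq_of_incl_incl _ _ i1 i2
  refine ⟨e, ?_⟩
  have := CategoryWithSubobjects.mono_of_incl j' hj'
  rw [← cancel_mono j', Category.assoc, ← he, h1, h]

end SubobjectFacts

section Normal

variable {C : Type u} [Category.{v} C] [NormalCategory C]

/-- In a normal category every epimorphism is a retraction followed by an isomorphism. -/
theorem exists_section_of_epi {X Y : C} (p : X ⟶ Y) [Epi p] :
    ∃ (A : C) (q : X ⟶ A) (w : A ⟶ Y), IsRetr q ∧ IsIso w ∧ p = q ≫ w := by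
  obtain ⟨A, B, q, w, j, hq, hw, hj, hf⟩ := NormalCategory.normal_factorisation p
  obtain ⟨r, hr⟩ := NormalCategory.split j hj
  have : Epi j := by
    have : Epi ((q ≫ w) ≫ j) := by rw [Category.assoc, ← hf]; infer_instance
    exact epi_of_epi (q ≫ w) j
  have hr' : r ≫ j = 𝟙 Y := by
    rw [← cancel_epi j, ← Category.assoc, hr, Category.id_comp, Category.comp_id]
  have ir : IsInclusion r := CategoryWithSubobjects.incl_of_comp r j
    (by rw [hr']; exact CategoryWithSubobjects.id_incl _) hj
  obtain ⟨e, he⟩ := eq_of_incl_incl j r hj ir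
  subst e
  refine ⟨A, q, w, hq, hw, ?_⟩
  rw [hf, he]
  simp

/-- Uniqueness of the canonical factorisation `f = p j` with `p` an epimorphism and `j` an
inclusion. -/
theorem canonical_unique {X Z Z' Y : C} (p : X ⟶ Z) (j : Z ⟶ Y) (p' : X ⟶ Z') (j' : Z' ⟶ Y)
    [Epi p] [Epi p'] (hj : IsInclusion j) (hj' : IsInclusion j') (h : p ≫ j = p' ≫ j') :
    ∃ e : Z = Z', p ≫ eqToHom e = p' := by
  refine eq_of_section p j p' j' ?_ ?_ hj hj' h
  · obtain ⟨A, q, w, hq, hw, rfl⟩ := exists_section_of_epi p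
    exact hq.exists_section w
  · obtain ⟨A, q, w, hq, hw, rfl⟩ := exists_section_of_epi p'
    exact hq.exists_section w

theorem exists_canonical {X Y : C} (f : X ⟶ Y) :
    ∃ (Z : C) (p : X ⟶ Z) (j : Z ⟶ Y), Epi p ∧ IsInclusion j ∧ p ≫ j = f := by
  obtain ⟨A, B, q, w, j, hq, hw, hj, hf⟩ := NormalCategory.normal_factorisation f
  refine ⟨B, q ≫ w, j, ?_, hj, by rw [hf, Category.assoc]⟩
  obtain ⟨s, hs⟩ := hq.exists_section w
  exact (IsSplitEpi.mk' ⟨s, hs⟩).epi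

/-- The image of `f`: the middle object of the canonical factorisation of `f`. -/
noncomputable def im {X Y : C} (f : X ⟶ Y) : C := (exists_canonical f).choose

/-- The epimorphic component `f°` of `f`. -/
noncomputable def epiPart {X Y : C} (f : X ⟶ Y) : X ⟶ im f :=
  (exists_canonical f).choose_spec.choose

/-- The inclusion of `f`. -/
noncomputable def inclPart {X Y : C} (f : X ⟶ Y) : im f ⟶ Y :=
  (exists_canonical f).choose_spec.choose_spec.choose

instance epi_epiPart {X Y : C} (f : X ⟶ Y) : Epi (epiPart f) :=
  (exists_canonical f).choose_spec.choose_spec.choose_spec.1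

theorem inclPart_incl {X Y : C} (f : X ⟶ Y) : IsInclusion (inclPart f) :=
  (exists_canonical f).choose_spec.choose_spec.choose_spec.2.1

theorem epiPart_inclPart {X Y : C} (f : X ⟶ Y) : epiPart f ≫ inclPart f = f :=
  (exists_canonical f).choose_spec.choose_spec.choose_spec.2.2

/-- The cone `γ ∗ p : c ↦ γ(c) p`, for an epimorphism `p` starting at the vertex of `γ`. -/
def ConeAt.star {z y : C} (γ : ConeAt z) (p : z ⟶ y) [Epi p] : ConeAt y where
  app c := γ.app c ≫ p
  incl_app j hj := by rw [← Category.assoc, γ.incl_app j hj]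
  exists_isIso := by
    obtain ⟨d, hd⟩ := γ.exists_isIso
    obtain ⟨A, q, w, ⟨j, hj, hjq⟩, hw, rfl⟩ := exists_section_of_epi p
    obtain ⟨c, m, i, hm, hi, hmi⟩ := exists_canonical (j ≫ inv (γ.app d))
    have : Mono j := CategoryWithSubobjects.mono_of_incl j hj
    have : Mono (m ≫ i) := by rw [hmi]; infer_instance
    have : Mono m := mono_of_mono m i
    have hms : ∃ s : c ⟶ A, s ≫ m = 𝟙 c := by
      obtain ⟨B, q', w', hq', hw', h'⟩ := exists_section_of_epi m
      subst h'
      exact hq'.exists_section w'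
    obtain ⟨s, hs⟩ := hms
    have hs' : m ≫ s = 𝟙 A := by
      rw [← cancel_mono m, Category.assoc, hs, Category.id_comp, Category.comp_id]
    have key : γ.app c ≫ q = s := by
      have h1 : m ≫ γ.app c = j := by
        rw [← γ.incl_app i hi, ← Category.assoc, hmi, Category.assoc, IsIso.inv_hom_id,
          Category.comp_id]
      have h2 : m ≫ (γ.app c ≫ q) = m ≫ s := by rw [← Category.assoc, h1, hjq, hs']
      exact (cancel_epi m).1 h2
    have : IsIso s := ⟨m, hs, hs'⟩
    refine ⟨c, ?_⟩
    rw [← Category.assoc, key]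
    infer_instance

/-! ### The semigroup of cones and the poset of its `R`-classes -/

variable (C) in
/-- The set `Ĉ` of all cones in `C`. -/
structure Cones where
  vertex : C
  cone : ConeAt vertex

theorem Cones.ext_eqToHom {γ δ : Cones C} (h : γ.vertex = δ.vertex)
    (H : ∀ c, γ.cone.app c ≫ eqToHom h = δ.cone.app c) : γ = δ := by
  obtain ⟨z, γ⟩ := γ
  obtain ⟨y, δ⟩ := δ
  dsimp at h
  subst h
  congr 1
  ext c
  simpa using H c

theorem Cones.exists_eqToHom {γ δ : Cones C} (H : γ = δ) :
    ∃ h : γ.vertex = δ.vertex, ∀ c, γ.cone.app c ≫ eqToHom h = δ.cone.app c := by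
  subst H
  exact ⟨rfl, fun c => by simp⟩

/-- The product `γ · δ = γ ∗ (δ(z_γ))°`. -/
noncomputable instance : Mul (Cones C) where
  mul γ δ := ⟨im (δ.cone.app γ.vertex), γ.cone.star (epiPart (δ.cone.app γ.vertex))⟩

theorem Cones.mul_vertex (γ δ : Cones C) : (γ * δ).vertex = im (δ.cone.app γ.vertex) := rfl

theorem Cones.mul_app (γ δ : Cones C) (c : C) :
    (γ * δ).cone.app c = γ.cone.app c ≫ epiPart (δ.cone.app γ.vertex) := rfl

noncomputable instance : Semigroup (Cones C) where
  mul_assoc γ δ κ := by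
    have h : ∃ e : im (κ.cone.app (im (δ.cone.app γ.vertex))) = im ((δ * κ).cone.app γ.vertex),
        (epiPart (δ.cone.app γ.vertex) ≫ epiPart (κ.cone.app (im (δ.cone.app γ.vertex)))) ≫
          eqToHom e = epiPart ((δ * κ).cone.app γ.vertex) := by
      refine canonical_unique _ (inclPart (κ.cone.app (im (δ.cone.app γ.vertex)))) _
        (inclPart ((δ * κ).cone.app γ.vertex) ≫ inclPart (κ.cone.app δ.vertex))
        (inclPart_incl _)
        (CategoryWithSubobjects.comp_incl _ _ (inclPart_incl _) (inclPart_incl _)) ?_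
      rw [Category.assoc, epiPart_inclPart, ← Category.assoc, epiPart_inclPart, Cones.mul_app,
        Category.assoc, epiPart_inclPart, ← κ.cone.incl_app _ (inclPart_incl _), ← Category.assoc,
        epiPart_inclPart]
    obtain ⟨e, he⟩ := h
    refine Cones.ext_eqToHom e fun c => ?_
    rw [Cones.mul_app γ (δ * κ), ← he]
    change ((γ.cone.app c ≫ epiPart (δ.cone.app γ.vertex)) ≫
      epiPart (κ.cone.app (im (δ.cone.app γ.vertex)))) ≫ eqToHom e = _
    simp only [Category.assoc]

theorem Cones.mul_eq_left {z : C} (γ δ : ConeAt z) (h : δ.app z = 𝟙 z) :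
    (⟨z, γ⟩ * ⟨z, δ⟩ : Cones C) = ⟨z, γ⟩ := by
  obtain ⟨e, he⟩ := canonical_unique (epiPart (δ.app z)) (inclPart (δ.app z)) (𝟙 z) (𝟙 z)
    (inclPart_incl _) (CategoryWithSubobjects.id_incl z)
    (by rw [epiPart_inclPart, h, Category.comp_id])
  refine Cones.ext_eqToHom e fun c => ?_
  change (γ.app c ≫ epiPart (δ.app z)) ≫ eqToHom e = γ.app c
  rw [Category.assoc, he, Category.comp_id]

/-- The quasi-order `γ ≤ᵣ δ ↔ γ ∈ δ Ĉ` on the semigroup of cones. -/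
instance : Preorder (Cones C) where
  le γ δ := ∃ χ : Cones C, γ = δ * χ
  le_refl γ := by
    obtain ⟨z, γ⟩ := γ
    obtain ⟨μ, hμ⟩ := NormalCategory.exists_cone z
    exact ⟨⟨z, μ⟩, (Cones.mul_eq_left γ μ hμ).symm⟩
  le_trans γ δ κ := by
    rintro ⟨χ, rfl⟩ ⟨ψ, rfl⟩
    exact ⟨ψ * χ, mul_assoc _ _ _⟩

variable (C) in
/-- The poset `Ĉ / R` of the `R`-classes of the semigroup of cones, where
`R = ≤ᵣ ∩ (≤ᵣ)⁻¹`, ordered by `R_γ ⊑ R_δ ↔ γ ≤ᵣ δ`. -/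
abbrev RClasses := Antisymmetrization (Cones C) (· ≤ ·)

/-- The `R`-class of the cone `γ` with vertex `c`. -/
def rClass {c : C} (γ : ConeAt c) : RClasses C :=
  toAntisymmetrization (· ≤ ·) (⟨c, γ⟩ : Cones C)

/-- The cone `ε` with vertex `c` is an idempotent of the semigroup of cones. -/
def ConeAt.IsIdem {c : C} (ε : ConeAt c) : Prop := IsIdempotentElem (⟨c, ε⟩ : Cones C)

/-- The object `c` is connected by `d`: the `R`-class `d` contains an idempotent cone with
vertex `c`. -/
def IsConnectedBy (c : C) (d : RClasses C) : Prop :=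
  ∃ ε : ConeAt c, ε.IsIdem ∧ rClass ε = d

theorem ConeAt.IsIdem.app_vertex {c : C} {ε : ConeAt c} (h : ε.IsIdem) : ε.app c = 𝟙 c := by
  obtain ⟨e, he⟩ := Cones.exists_eqToHom h
  obtain ⟨d, hd⟩ := ε.exists_isIso
  have h1 := he d
  change (ε.app d ≫ epiPart (ε.app c)) ≫ eqToHom e = ε.app d at h1
  rw [Category.assoc] at h1
  have h2 : epiPart (ε.app c) ≫ eqToHom e = 𝟙 c := by
    rw [← cancel_epi (ε.app d), h1, Category.comp_id]
  have h3 : inclPart (ε.app c) = eqToHom e :=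
    CategoryWithSubobjects.incl_unique _ _ (inclPart_incl _) (incl_eqToHom e)
  rw [← epiPart_inclPart (ε.app c), h3, h2]

/-- An idempotent cone is determined by its vertex and its `R`-class. -/
theorem idem_unique {c : C} {ε ε' : ConeAt c} (h : ε.IsIdem) (h' : ε'.IsIdem)
    (hr : rClass ε = rClass ε') : ε = ε' := by
  have hle : (⟨c, ε⟩ : Cones C) ≤ ⟨c, ε'⟩ := (Quotient.exact hr).1
  obtain ⟨χ, hχ⟩ := hle
  have h1 : (⟨c, ε'⟩ * ⟨c, ε⟩ : Cones C) = ⟨c, ε⟩ := by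
    rw [hχ, ← mul_assoc, h'.eq]
  have h2 := Cones.mul_eq_left ε' ε h.app_vertex
  have h3 : (⟨c, ε⟩ : Cones C) = ⟨c, ε'⟩ := h1.symm.trans h2
  simpa using h3

/-- The unique idempotent cone `ε(c, d)` with vertex `c` in the `R`-class `d`, for an object `c`
connected by `d`. -/
noncomputable def idemCone {c : C} {d : RClasses C} (h : IsConnectedBy c d) : ConeAt c :=
  h.choose

theorem idemCone_isIdem {c : C} {d : RClasses C} (h : IsConnectedBy c d) :
    (idemCone h).IsIdem := h.choose_spec.1

theorem rClass_idemCone {c : C} {d : RClasses C} (h : IsConnectedBy c d) :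
    rClass (idemCone h) = d := h.choose_spec.2

end Normal

/-! ### Connected, supported and self-supported categories -/

/-- A connected category: a small normal category together with a down-set `down` of the poset of
`R`-classes of its semigroup of cones such that every object is connected by some element of
the down-set. -/
structure ConnectedCat where
  carrier : Type u
  [cat : SmallCategory carrier]
  [normal : NormalCategory carrier]
  down : LowerSet (RClasses carrier)
  connected : ∀ c : carrier, ∃ d : down, IsConnectedBy c d.1

attribute [instance] ConnectedCat.cat ConnectedCat.normal

/-- Morphisms of connected categories: pairs of an inclusion preserving functor `F` and an order
preserving map `G` of the down-sets such that, whenever `c` is connected by `d`, the object `F c`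
is connected by `G d` and `F(ε(c, d)(c')) = ε(F c, G d)(F c')` for every object `c'`. -/
@[ext]
structure CCHom (X Y : ConnectedCat.{u}) where
  functor : X.carrier ⥤ Y.carrier
  map_incl : ∀ {a b : X.carrier} (j : a ⟶ b), IsInclusion j → IsInclusion (functor.map j)
  onDown : X.down →o Y.down
  map_connected : ∀ (c : X.carrier) (d : X.down), IsConnectedBy c d.1 →
    IsConnectedBy (functor.obj c) (onDown d).1
  map_idemCone : ∀ (c : X.carrier) (d : X.down) (h : IsConnectedBy c d.1) (c' : X.carrier),
    functor.map ((idemCone h).app c') =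
      (idemCone (map_connected c d h)).app (functor.obj c')

/-- The category of connected categories. -/
instance : Category ConnectedCat.{u} where
  Hom := CCHom
  id X :=
    { functor := 𝟭 X.carrier
      map_incl := fun _ hj => hj
      onDown := OrderHom.id
      map_connected := fun _ _ h => h
      map_idemCone := fun _ _ _ _ => rfl }
  comp m n :=
    { functor := m.functor ⋙ n.functor
      map_incl := fun j hj => n.map_incl _ (m.map_incl j hj)
      onDown := n.onDown.comp m.onDown
      map_connected := fun c d h => n.map_connected _ _ (m.map_connected c d h)
      map_idemCone := fun c d h c' => by
        rw [Functor.comp_map, m.map_idemCone c d h c',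
          n.map_idemCone _ _ (m.map_connected c d h)]
        rfl }

/-- A connected category is supported if each object is connected by a unique element of the
down-set. -/
def IsSupported (X : ConnectedCat.{u}) : Prop :=
  ∀ c : X.carrier, ∃! d : X.down, IsConnectedBy c d.1

/-- The support map of a supported category: it sends an object `c` to the element of the down-set
by which `c` is connected. -/
noncomputable def supportMap {X : ConnectedCat.{u}} (hX : IsSupported X) (c : X.carrier) : X.down :=
  (hX c).choose

/-- A self-supported category: a supported category whose support map is an order isomorphism
from the poset of objects onto the down-set. -/
def IsSelfSupported : ObjectProperty ConnectedCat.{u} := fun X =>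
  ∃ hX : IsSupported X, Function.Bijective (supportMap hX) ∧
    ∀ a b : X.carrier, SubLE a b ↔ supportMap hX a ≤ supportMap hX b

/-- The category of self-supported categories, a full subcategory of the category of connected
categories. -/
abbrev SelfSupportedCat := IsSelfSupported.{u}.FullSubcategory

/-! ### Inverse semigroups -/

/-- Inverse semigroups: every element `a` has an inverse `x`, and the idempotents commute. -/
def IsInverseSemigroup : ObjectProperty Semigrp.{u} := fun S =>
  (∀ a : S, ∃ x : S, a * x * a = a ∧ x * a * x = x) ∧
    ∀ e f : S, IsIdempotentElem e → IsIdempotentElem f → e * f = f * e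

/-- The category of inverse semigroups, with semigroup homomorphisms as morphisms. -/
abbrev InverseSemigrp := IsInverseSemigroup.{u}.FullSubcategory

end ConeSemigroups

namespace ConeSemigroups

/-! ### Products of cones -/

section Normal

variable {C : Type u} [Category.{v} C] [NormalCategory C]

/-! In an inverse semigroup `S` each principal left ideal has a unique idempotent generator, so the
category of principal left ideals may be taken to have the idempotents as objects and the elements
of `e S f` as morphisms `e ⟶ f`. Each `a` gives a cone `f ↦ f a`, and `a ↦ principal a` embeds `S`
in the semigroup of cones. By `principal_mul` its image is a right ideal, so the R-classes meeting
it form a down-set and contain only principal cones. The only idempotent cone with vertex `e` there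
is that of `e` itself, and `S e ⊆ S f` amounts to `e S ⊆ f S` because idempotents commute; the
result is self-supported.

The assignment is fully faithful. A morphism of connected categories preserves inclusions and the
components `f e : f ⟶ e` of the idempotent cones, among them the canonical retractions. Hence the
element carried by the image of a morphism depends only on the element `a` it carries
(`val_map_isoOf`), which defines `φ a`; the preserved components make `φ` multiplicative. The map on
down-sets is determined by the functor (`CCHom.ext_functor`).

It is essentially surjective. For self-supported `X`, the cones with R-class in the down-set form a
semigroup whose idempotents correspond to the objects of `X`. Bijectivity of the support map makes
this semigroup regular with one idempotent in each R-class, and support gives one in each L-class,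
so it is inverse (`inverseLaws_supportSemigroup`). Sending an idempotent cone to its vertex
identifies the category of left ideals with `X`. -/

theorem Cones.mul_eq_star (γ δ : Cones C) {y : C} (p : γ.vertex ⟶ y) [Epi p]
    (j : y ⟶ δ.vertex) (hj : IsInclusion j) (h : δ.cone.app γ.vertex = p ≫ j) :
    γ * δ = ⟨y, γ.cone.star p⟩ := by
  obtain ⟨e, he⟩ := canonical_unique (epiPart (δ.cone.app γ.vertex))
    (inclPart (δ.cone.app γ.vertex)) p j (inclPart_incl _) hj (by rw [epiPart_inclPart, h])
  refine Cones.ext_eqToHom e fun c => ?_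
  change (γ.cone.app c ≫ epiPart (δ.cone.app γ.vertex)) ≫ eqToHom e = γ.cone.app c ≫ p
  rw [Category.assoc, he]

theorem ConeAt.star_id {z : C} (γ : ConeAt z) : γ.star (𝟙 z) = γ := by
  ext c
  exact Category.comp_id _

/-- By compatibility, the component of `δ` at the vertex of `γ` is an inclusion, so its epimorphic
part is trivial. -/
theorem Cones.mul_eq_left_of_subLE (γ δ : Cones C) (hδ : δ.cone.app δ.vertex = 𝟙 _)
    (h : SubLE γ.vertex δ.vertex) : γ * δ = γ := by
  obtain ⟨j, hj⟩ := h
  rw [Cones.mul_eq_star γ δ (𝟙 _) j hj, ConeAt.star_id]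
  rw [← δ.cone.incl_app j hj, hδ, Category.comp_id, Category.id_comp]

theorem Cones.subLE_of_mul_eq {γ δ κ : Cones C} (h : γ * δ = κ) :
    SubLE κ.vertex δ.vertex := by
  subst h
  exact ⟨inclPart (δ.cone.app γ.vertex), inclPart_incl _⟩

/-- A cone fixed by left multiplication by such a `γ` is determined by one component, the one at the
vertex of `γ`: evaluating `γ * δ = δ` there identifies the epimorphic factor in the product. -/
theorem Cones.app_eq_of_mul_eq {γ δ : Cones C} (hγ : γ.cone.app γ.vertex = 𝟙 _)
    (h : γ * δ = δ) :
    Epi (δ.cone.app γ.vertex) ∧ ∀ c, δ.cone.app c = γ.cone.app c ≫ δ.cone.app γ.vertex := by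
  obtain ⟨e, he⟩ := Cones.exists_eqToHom h
  have h1 := he γ.vertex
  rw [Cones.mul_app, hγ, Category.id_comp] at h1
  constructor
  · rw [← h1]
    infer_instance
  · intro c
    have h2 := he c
    rw [Cones.mul_app, Category.assoc, h1] at h2
    exact h2.symm

theorem SubLE.antisymm {a b : C} (h : SubLE a b) (h' : SubLE b a) : a = b := by
  obtain ⟨j, hj⟩ := h
  obtain ⟨k, hk⟩ := h'
  exact (eq_of_incl_incl j k hj hk).choose

theorem Cones.mul_le (γ δ : Cones C) : γ * δ ≤ γ := ⟨δ, rfl⟩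

theorem Cones.mul_eq_right_of_le {γ δ : Cones C} (hδ : IsIdempotentElem δ) (h : γ ≤ δ) :
    δ * γ = γ := by
  obtain ⟨χ, rfl⟩ := h
  rw [← mul_assoc, hδ.eq]

end Normal

/-! ### Supported and self-supported categories -/

section Supported

variable {X Y : ConnectedCat.{u}}

theorem isConnectedBy_supportMap (hX : IsSupported X) (c : X.carrier) :
    IsConnectedBy c (supportMap hX c).1 := (hX c).choose_spec.1

theorem eq_supportMap (hX : IsSupported X) {c : X.carrier} {d : X.down}
    (h : IsConnectedBy c d.1) : d = supportMap hX c := (hX c).choose_spec.2 d h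

/-- The idempotent cone with vertex `c` in the support of `c`. -/
noncomputable def suppCone (hX : IsSupported X) (c : X.carrier) : ConeAt c :=
  idemCone (isConnectedBy_supportMap hX c)

theorem suppCone_isIdem (hX : IsSupported X) (c : X.carrier) : (suppCone hX c).IsIdem :=
  idemCone_isIdem _

theorem rClass_suppCone (hX : IsSupported X) (c : X.carrier) :
    rClass (suppCone hX c) = (supportMap hX c).1 := rClass_idemCone _

theorem rClass_suppCone_mem (hX : IsSupported X) (c : X.carrier) :
    rClass (suppCone hX c) ∈ X.down := by
  rw [rClass_suppCone]
  exact (supportMap hX c).2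

theorem rClass_eq_supportMap (hX : IsSupported X) {c : X.carrier} {ε : ConeAt c} (hε : ε.IsIdem)
    (hd : rClass ε ∈ X.down) : rClass ε = (supportMap hX c).1 :=
  congrArg Subtype.val (eq_supportMap hX (d := ⟨rClass ε, hd⟩) ⟨ε, hε, rfl⟩)

theorem eq_suppCone (hX : IsSupported X) {c : X.carrier} {ε : ConeAt c} (hε : ε.IsIdem)
    (hd : rClass ε ∈ X.down) : ε = suppCone hX c :=
  idem_unique hε (suppCone_isIdem hX c)
    ((rClass_eq_supportMap hX hε hd).trans (rClass_suppCone hX c).symm)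

theorem idemCone_eq_suppCone (hX : IsSupported X) {c : X.carrier} {d : X.down}
    (h : IsConnectedBy c d.1) : idemCone h = suppCone hX c :=
  eq_suppCone hX (idemCone_isIdem h) (by rw [rClass_idemCone]; exact d.2)

theorem IsSelfSupported.supported (h : IsSelfSupported X) : IsSupported X := h.choose

theorem IsSelfSupported.bijective (h : IsSelfSupported X) :
    Function.Bijective (supportMap h.supported) := h.choose_spec.1

theorem IsSelfSupported.subLE_iff (h : IsSelfSupported X) (a b : X.carrier) :
    SubLE a b ↔ supportMap h.supported a ≤ supportMap h.supported b := h.choose_spec.2 a b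

/-- The support map as a bijection. -/
noncomputable def IsSelfSupported.supportEquiv (h : IsSelfSupported X) : X.carrier ≃ X.down :=
  Equiv.ofBijective _ h.bijective

theorem IsSelfSupported.supportMap_symm (h : IsSelfSupported X) (d : X.down) :
    supportMap h.supported (h.supportEquiv.symm d) = d :=
  h.supportEquiv.apply_symm_apply d

/-- Between self-supported categories, an inclusion preserving functor that preserves the
idempotent cones of the supports extends to a morphism of connected categories. -/
noncomputable def CCHom.ofFunctor (hX : IsSelfSupported X) (hY : IsSelfSupported Y)
    (F : X.carrier ⥤ Y.carrier)
    (hF : ∀ {a b : X.carrier} (j : a ⟶ b), IsInclusion j → IsInclusion (F.map j))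
    (hε : ∀ c c' : X.carrier, F.map ((suppCone hX.supported c).app c') =
      (suppCone hY.supported (F.obj c)).app (F.obj c')) : CCHom X Y where
  functor := F
  map_incl := hF
  onDown :=
    { toFun := fun d => supportMap hY.supported (F.obj (hX.supportEquiv.symm d))
      -- The support map of `X` turns `d ≤ d'` into an inclusion, `F` preserves it, and the support
      -- map of `Y` turns it back into an inequality.
      monotone' := fun d d' h => by
        rw [← hY.subLE_iff]
        obtain ⟨j, hj⟩ := (hX.subLE_iff (hX.supportEquiv.symm d) (hX.supportEquiv.symm d')).2
          (by rwa [hX.supportMap_symm, hX.supportMap_symm])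
        exact ⟨F.map j, hF j hj⟩ }
  map_connected c d h := by
    have : hX.supportEquiv.symm d = c := by
      rw [Equiv.symm_apply_eq]
      exact eq_supportMap hX.supported h
    change IsConnectedBy _ (supportMap hY.supported (F.obj (hX.supportEquiv.symm d))).1
    rw [this]
    exact isConnectedBy_supportMap _ _
  map_idemCone c d h c' := by
    rw [idemCone_eq_suppCone hX.supported, hε, idemCone_eq_suppCone hY.supported]

theorem CCHom.map_suppCone (hX : IsSupported X) (hY : IsSupported Y) (m : CCHom X Y)
    (c c' : X.carrier) : m.functor.map ((suppCone hX c).app c') =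
      (suppCone hY (m.functor.obj c)).app (m.functor.obj c') := by
  have h := isConnectedBy_supportMap hX c
  have := m.map_idemCone c _ h c'
  rwa [idemCone_eq_suppCone hX, idemCone_eq_suppCone hY] at this

/-- Every `d` is the support of some object `c`, and its image must connect `F c`, which only one
element of the down-set does. -/
theorem CCHom.ext_functor (hX : IsSelfSupported X) (hY : IsSelfSupported Y) {m n : CCHom X Y}
    (h : m.functor = n.functor) : m = n := by
  refine CCHom.ext h ?_
  refine OrderHom.ext _ _ (funext fun d => ?_)
  have hc : IsConnectedBy (hX.supportEquiv.symm d) d.1 := by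
    have := isConnectedBy_supportMap hX.supported (hX.supportEquiv.symm d)
    rwa [hX.supportMap_symm] at this
  have hm := m.map_connected _ _ hc
  have hn := n.map_connected _ _ hc
  rw [← h] at hn
  exact (eq_supportMap hY.supported hm).trans (eq_supportMap hY.supported hn).symm

end Supported

/-! ### Strict inverses and isomorphisms of self-supported categories -/

section Iso

variable {A B : Type u} [SmallCategory A] [SmallCategory B]

theorem obj_ofBijective_symm (F : A ⥤ B) (hF : Function.Bijective F.obj) (b : B) :
    F.obj ((Equiv.ofBijective F.obj hF).symm b) = b :=
  (Equiv.ofBijective F.obj hF).apply_symm_apply b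

/-- The strict inverse of a fully faithful functor that is bijective on objects. -/
noncomputable def strictInverse (F : A ⥤ B) [F.Full] [F.Faithful]
    (hF : Function.Bijective F.obj) : B ⥤ A where
  obj b := (Equiv.ofBijective F.obj hF).symm b
  map f := F.preimage (eqToHom (obj_ofBijective_symm F hF _) ≫ f ≫
    eqToHom (obj_ofBijective_symm F hF _).symm)
  map_id b := by
    apply F.map_injective
    simp
  map_comp f g := by
    apply F.map_injective
    simp

variable (F : A ⥤ B) [F.Full] [F.Faithful] (hF : Function.Bijective F.obj)

theorem obj_strictInverse_obj (b : B) : F.obj ((strictInverse F hF).obj b) = b :=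
  (Equiv.ofBijective F.obj hF).apply_symm_apply _

theorem strictInverse_obj_obj (a : A) : (strictInverse F hF).obj (F.obj a) = a :=
  (Equiv.ofBijective F.obj hF).symm_apply_apply _

theorem map_strictInverse_map {b b' : B} (f : b ⟶ b') :
    F.map ((strictInverse F hF).map f) = eqToHom (obj_strictInverse_obj F hF b) ≫ f ≫
      eqToHom (obj_strictInverse_obj F hF b').symm :=
  F.map_preimage _

theorem strictInverse_comp : strictInverse F hF ⋙ F = 𝟭 B :=
  CategoryTheory.Functor.ext (obj_strictInverse_obj F hF)
    fun _ _ f => map_strictInverse_map F hF f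

theorem comp_strictInverse : F ⋙ strictInverse F hF = 𝟭 A := by
  refine CategoryTheory.Functor.ext (strictInverse_obj_obj F hF) fun a a' f => ?_
  apply F.map_injective
  simp [map_strictInverse_map, eqToHom_map]

end Iso

theorem ConeAt.family_app_eq {C : Type u} [SmallCategory C] [CategoryWithSubobjects C]
    (ε : ∀ c : C, ConeAt c) {c₁ c₂ d₁ d₂ : C} (h : c₁ = c₂) (h' : d₁ = d₂) :
    (ε c₁).app d₁ = eqToHom h' ≫ (ε c₂).app d₂ ≫ eqToHom h.symm := by
  subst h h'
  simp

theorem isInclusion_eqToHom_comp {C : Type u} [SmallCategory C] [CategoryWithSubobjects C]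
    {c₁ c₂ d₁ d₂ : C} (h : c₁ = c₂) (h' : d₁ = d₂) (j : c₂ ⟶ d₁) (hj : IsInclusion j) :
    IsInclusion (eqToHom h ≫ j ≫ eqToHom h') :=
  CategoryWithSubobjects.comp_incl _ _ (incl_eqToHom h)
    (CategoryWithSubobjects.comp_incl _ _ hj (incl_eqToHom h'))

/-- The strict inverse of `F` respects inclusions because `F` reflects them, and idempotent cones
because `F` is faithful; the maps of down-sets come for free from `CCHom.ofFunctor`. -/
theorem nonempty_iso_of_functor (X Y : SelfSupportedCat.{u})
    (F : X.obj.carrier ⥤ Y.obj.carrier) [F.Full] [F.Faithful] (hF : Function.Bijective F.obj)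
    (hincl : ∀ {a b : X.obj.carrier} (j : a ⟶ b), IsInclusion (F.map j) ↔ IsInclusion j)
    (hε : ∀ c c' : X.obj.carrier, F.map ((suppCone X.property.supported c).app c') =
      (suppCone Y.property.supported (F.obj c)).app (F.obj c')) : Nonempty (X ≅ Y) := by
  let m : CCHom X.obj Y.obj := CCHom.ofFunctor X.property Y.property F (fun j => (hincl j).2) hε
  let n : CCHom Y.obj X.obj := CCHom.ofFunctor Y.property X.property (strictInverse F hF)
    (fun j hj => by
      rw [← hincl, map_strictInverse_map]
      exact isInclusion_eqToHom_comp _ _ j hj)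
    (fun c c' => by
      apply F.map_injective
      rw [hε, map_strictInverse_map]
      exact (ConeAt.family_app_eq _ (obj_strictInverse_obj F hF c) _).symm)
  let i : X.obj ≅ Y.obj :=
    { hom := m
      inv := n
      hom_inv_id := CCHom.ext_functor X.property X.property (comp_strictInverse F hF)
      inv_hom_id := CCHom.ext_functor Y.property Y.property (strictInverse_comp F hF) }
  exact ⟨ObjectProperty.isoMk _ i⟩

/-! ### Inverse semigroups -/

/-- The laws of inverse semigroups, for an unbundled semigroup. -/
class InverseLaws (S : Type u) [Semigroup S] : Prop where
  exists_inv : ∀ a : S, ∃ x : S, a * x * a = a ∧ x * a * x = x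
  idem_comm : ∀ e f : S, IsIdempotentElem e → IsIdempotentElem f → e * f = f * e

section InverseLaws

variable {S : Type u} [Semigroup S] [InverseLaws S]

/-- The inverse of an element of an inverse semigroup. -/
noncomputable def pinv (a : S) : S := (InverseLaws.exists_inv a).choose

theorem mul_pinv_mul (a : S) : a * pinv a * a = a := (InverseLaws.exists_inv a).choose_spec.1

theorem pinv_mul_pinv (a : S) : pinv a * a * pinv a = pinv a :=
  (InverseLaws.exists_inv a).choose_spec.2

theorem isIdem_mul_of_inv {S : Type u} [Semigroup S] {a x : S} (h : a * x * a = a) :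
    IsIdempotentElem (a * x) := by
  rw [IsIdempotentElem, ← mul_assoc, h]

theorem isIdem_mul_pinv (a : S) : IsIdempotentElem (a * pinv a) :=
  isIdem_mul_of_inv (mul_pinv_mul a)

theorem isIdem_pinv_mul (a : S) : IsIdempotentElem (pinv a * a) :=
  isIdem_mul_of_inv (pinv_mul_pinv a)

theorem eq_of_mul_eq_of_mul_eq {e f : S} (he : IsIdempotentElem e) (hf : IsIdempotentElem f)
    (h : e * f = e) (h' : f * e = f) : e = f := by
  rw [← h, InverseLaws.idem_comm e f he hf, h']

/-- The hypotheses say that `a` and `b` generate the same left ideal, so its idempotent generators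
coincide. -/
theorem pinv_mul_eq_of_mul {a b x y : S} (h : x * a = b) (h' : y * b = a) :
    pinv a * a = pinv b * b := by
  have ha : a * (pinv b * b) = a := by
    calc a * (pinv b * b) = y * (b * pinv b * b) := by rw [← h']; simp only [mul_assoc]
      _ = a := by rw [mul_pinv_mul, h']
  have hb : b * (pinv a * a) = b := by
    calc b * (pinv a * a) = x * (a * pinv a * a) := by rw [← h]; simp only [mul_assoc]
      _ = b := by rw [mul_pinv_mul, h]
  refine eq_of_mul_eq_of_mul_eq (isIdem_pinv_mul a) (isIdem_pinv_mul b) ?_ ?_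
  · rw [mul_assoc, ha]
  · rw [mul_assoc, hb]

theorem pinv_mul_self_of_isIdem {e : S} (he : IsIdempotentElem e) : pinv e * e = e := by
  have h1 : pinv e * e * e = pinv e * e := by rw [mul_assoc, he.eq]
  have h2 : e * (pinv e * e) = e := by rw [← mul_assoc, mul_pinv_mul]
  exact eq_of_mul_eq_of_mul_eq (isIdem_pinv_mul e) he h1 h2

end InverseLaws

/-! ### The category of principal left ideals -/

/-- The objects of the category of principal left ideals of an inverse semigroup: each principal
left ideal has a unique idempotent generator. -/
@[ext]
structure LeftIdeal (S : Type u) [Semigroup S] where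
  gen : S
  idem : IsIdempotentElem gen

/-- The morphisms `S e ⟶ S f` are the right translations by the elements of `e S f`. -/
@[ext]
structure LeftIdeal.Hom {S : Type u} [Semigroup S] (e f : LeftIdeal S) where
  val : S
  left : e.gen * val = val
  right : val * f.gen = val

section LeftIdeal

variable {S : Type u} [Semigroup S]

instance : SmallCategory (LeftIdeal S) where
  Hom := LeftIdeal.Hom
  id e := ⟨e.gen, e.idem, e.idem⟩
  comp a b := ⟨a.val * b.val, by rw [← mul_assoc, a.left], by rw [mul_assoc, b.right]⟩
  id_comp a := LeftIdeal.Hom.ext a.left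
  comp_id a := LeftIdeal.Hom.ext a.right
  assoc a b c := LeftIdeal.Hom.ext (mul_assoc _ _ _)

namespace LeftIdeal

/-- The element of `S` that defines a morphism. -/
def val {e f : LeftIdeal S} (a : e ⟶ f) : S := Hom.val a

/-- The morphism defined by an element of `e S f`. -/
def mk' (e f : LeftIdeal S) (a : S) (h : e.gen * a = a) (h' : a * f.gen = a) : e ⟶ f :=
  ⟨a, h, h'⟩

@[simp] theorem val_mk' (e f : LeftIdeal S) (a : S) (h : e.gen * a = a) (h' : a * f.gen = a) :
    val (mk' e f a h h') = a := rfl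

@[simp] theorem val_id (e : LeftIdeal S) : val (𝟙 e) = e.gen := rfl

@[simp] theorem val_comp {e f g : LeftIdeal S} (a : e ⟶ f) (b : f ⟶ g) :
    val (a ≫ b) = val a * val b := rfl

theorem gen_mul_val {e f : LeftIdeal S} (a : e ⟶ f) : e.gen * val a = val a := Hom.left a

theorem val_mul_gen {e f : LeftIdeal S} (a : e ⟶ f) : val a * f.gen = val a := Hom.right a

theorem hom_ext {e f : LeftIdeal S} {a b : e ⟶ f} (h : val a = val b) : a = b := Hom.ext h

@[simp] theorem val_comp_eqToHom {e f g : LeftIdeal S} (a : e ⟶ f) (h : f = g) :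
    val (a ≫ eqToHom h) = val a := by
  subst h
  simp

@[simp] theorem val_eqToHom_comp {e f g : LeftIdeal S} (h : e = f) (a : f ⟶ g) :
    val (eqToHom h ≫ a) = val a := by
  subst h
  simp

variable [InverseLaws S]

/-- Right translation by `e` is the identity on `S e`, so a morphism out of `e` is a set inclusion
exactly when it is carried by `e` itself. -/
instance : CategoryWithSubobjects (LeftIdeal S) where
  incl := fun {e _} a => val a = e.gen
  id_incl _ := rfl
  comp_incl {e f g} a b (ha : val a = e.gen) (hb : val b = f.gen) := by
    rw [val_comp, hb, val_mul_gen, ha]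
  incl_unique a b ha hb := hom_ext (Eq.trans ha (Eq.symm hb))
  incl_strict {e f} a b (ha : val a = e.gen) (hb : val b = f.gen) _ _ := by
    have h : e = f := LeftIdeal.ext (eq_of_mul_eq_of_mul_eq e.idem f.idem
      (by rw [← ha, val_mul_gen]) (by rw [← hb, val_mul_gen]))
    refine ⟨h, ?_⟩
    subst h
    exact hom_ext ha
  mono_of_incl {e f} a (ha : val a = e.gen) := by
    refine ⟨fun {g} b c h => hom_ext ?_⟩
    have := congrArg val h
    rwa [val_comp, val_comp, ha, val_mul_gen, val_mul_gen] at this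
  incl_of_comp {e f g} a b (hab : val (a ≫ b) = e.gen) (hb : val b = f.gen) := by
    rwa [val_comp, hb, val_mul_gen] at hab

theorem isInclusion_iff {e f : LeftIdeal S} (a : e ⟶ f) : IsInclusion a ↔ val a = e.gen := Iff.rfl

theorem subLE_iff {e f : LeftIdeal S} : SubLE e f ↔ e.gen * f.gen = e.gen := by
  constructor
  · rintro ⟨j, hj⟩
    rw [← (isInclusion_iff j).1 hj, val_mul_gen]
  · intro h
    exact ⟨mk' e f e.gen e.idem h, rfl⟩

/-- The left ideal generated by `a`. -/
noncomputable def ran (a : S) : LeftIdeal S := ⟨pinv a * a, isIdem_pinv_mul a⟩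

/-- The left ideal generated by the inverse of `a`. -/
noncomputable def dom (a : S) : LeftIdeal S := ⟨a * pinv a, isIdem_mul_pinv a⟩

theorem mul_gen_ran (a : S) : a * (ran a).gen = a := by
  rw [ran, ← mul_assoc, mul_pinv_mul]

theorem gen_dom_mul (a : S) : (dom a).gen * a = a := mul_pinv_mul a

theorem gen_ran_mul_pinv (a : S) : (ran a).gen * pinv a = pinv a := pinv_mul_pinv a

theorem pinv_mul_gen_dom (a : S) : pinv a * (dom a).gen = pinv a := by
  rw [dom, ← mul_assoc, pinv_mul_pinv]

/-- The isomorphism of left ideals defined by `a`. -/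
noncomputable def isoOf (a : S) : dom a ≅ ran a where
  hom := mk' _ _ a (gen_dom_mul a) (mul_gen_ran a)
  inv := mk' _ _ (pinv a) (gen_ran_mul_pinv a) (pinv_mul_gen_dom a)
  hom_inv_id := hom_ext rfl
  inv_hom_id := hom_ext rfl

/-- The corestriction of a morphism to its image. -/
noncomputable def toRan {e f : LeftIdeal S} (a : e ⟶ f) : e ⟶ ran (val a) :=
  mk' _ _ (val a) (gen_mul_val a) (mul_gen_ran _)

/-- The inclusion of the image of a morphism. -/
noncomputable def ranIncl {e f : LeftIdeal S} (a : e ⟶ f) : ran (val a) ⟶ f :=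
  mk' _ _ (ran (val a)).gen (ran (val a)).idem (by rw [ran, mul_assoc, val_mul_gen])

theorem ranIncl_isInclusion {e f : LeftIdeal S} (a : e ⟶ f) : IsInclusion (ranIncl a) := rfl

theorem toRan_ranIncl {e f : LeftIdeal S} (a : e ⟶ f) : toRan a ≫ ranIncl a = a :=
  hom_ext (mul_gen_ran (val a))

theorem gen_dom_val_mul {e f : LeftIdeal S} (a : e ⟶ f) :
    (dom (val a)).gen * e.gen = (dom (val a)).gen := by
  rw [InverseLaws.idem_comm _ _ (dom _).idem e.idem, dom, ← mul_assoc, gen_mul_val]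

/-- The retraction of the source of a morphism onto its coimage. -/
noncomputable def toDom {e f : LeftIdeal S} (a : e ⟶ f) : e ⟶ dom (val a) :=
  mk' _ _ (dom (val a)).gen (by rw [dom, ← mul_assoc, gen_mul_val]) (dom (val a)).idem

/-- The inclusion of the coimage of a morphism. -/
noncomputable def domIncl {e f : LeftIdeal S} (a : e ⟶ f) : dom (val a) ⟶ e :=
  mk' _ _ (dom (val a)).gen (dom (val a)).idem (gen_dom_val_mul a)

theorem domIncl_toDom {e f : LeftIdeal S} (a : e ⟶ f) : domIncl a ≫ toDom a = 𝟙 _ :=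
  hom_ext (dom (val a)).idem

instance epi_toRan {e f : LeftIdeal S} (a : e ⟶ f) : Epi (toRan a) :=
  (IsSplitEpi.mk' ⟨(isoOf (val a)).inv ≫ domIncl a, hom_ext (by
    change pinv (val a) * (dom (val a)).gen * val a = _
    rw [pinv_mul_gen_dom]
    rfl)⟩).epi

/-- The cone `f ↦ f a` with vertex the left ideal generated by `a`. -/
def principalCone (a : S) (z : LeftIdeal S) (h : pinv a * a = z.gen) : ConeAt z where
  app f := mk' f z (f.gen * a) (by rw [← mul_assoc, f.idem])
    (by rw [← h, mul_assoc, ← mul_assoc a, mul_pinv_mul])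
  incl_app {f g} j hj := hom_ext (by
    change val j * (g.gen * a) = f.gen * a
    rw [← mul_assoc, val_mul_gen, (isInclusion_iff j).1 hj])
  exists_isIso := by
    obtain rfl : z = ran a := LeftIdeal.ext h.symm
    refine ⟨dom a, ?_⟩
    have : mk' (dom a) (ran a) ((dom a).gen * a) (by rw [← mul_assoc, (dom a).idem])
        (by rw [mul_assoc, mul_gen_ran]) = (isoOf a).hom := hom_ext (gen_dom_mul a)
    rw [this]
    infer_instance

/-- An inclusion of `S e` is split by right translation by `e`, and `a = (a a⁻¹) a (a⁻¹ a)` is the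
normal factorisation. -/
instance : NormalCategory (LeftIdeal S) where
  split {e f} j hj := ⟨mk' f e e.gen (by
      rw [InverseLaws.idem_comm _ _ f.idem e.idem, ← (isInclusion_iff j).1 hj, val_mul_gen])
      e.idem.eq, hom_ext (by
        have := (isInclusion_iff j).1 hj
        rw [val_comp, val_mk', this, val_id]
        exact e.idem)⟩
  normal_factorisation {e f} a :=
    ⟨dom (val a), ran (val a), toDom a, (isoOf (val a)).hom, ranIncl a,
      ⟨domIncl a, rfl, domIncl_toDom a⟩, inferInstance, ranIncl_isInclusion a, hom_ext (by
        change val a = (dom (val a)).gen * (val a * (ran (val a)).gen)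
        rw [mul_gen_ran, gen_dom_mul])⟩
  exists_cone e := ⟨principalCone e.gen e (pinv_mul_self_of_isIdem e.idem), hom_ext e.idem⟩

/-- The principal cone of `a`, as an element of the semigroup of cones. -/
noncomputable def principal (a : S) : Cones (LeftIdeal S) := ⟨ran a, principalCone a _ rfl⟩

theorem principal_eq {a : S} {z : LeftIdeal S} (h : pinv a * a = z.gen) :
    principal a = ⟨z, principalCone a z h⟩ := by
  obtain rfl : z = ran a := LeftIdeal.ext h.symm
  rfl

theorem val_app_eq {γ δ : Cones (LeftIdeal S)} (h : γ = δ) (e : LeftIdeal S) :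
    val (γ.cone.app e) = val (δ.cone.app e) := by
  subst h
  rfl

/-- Components at `a a⁻¹` and `b b⁻¹` give `a = a a⁻¹ b` and `b = b b⁻¹ a`, so each of `a`, `b` lies
below the other in the natural order. -/
theorem principal_injective : Function.Injective (principal : S → Cones (LeftIdeal S)) := by
  intro a b h
  have key : ∀ {a b : S}, principal a = principal b → a = a * pinv a * b := by
    intro a b h
    have := val_app_eq h (dom a)
    change (dom a).gen * a = (dom a).gen * b at this
    rwa [gen_dom_mul] at this
  have h1 := key h
  have h2 := key h.symm
  calc a = a * pinv a * b := h1
    _ = (a * pinv a) * (b * pinv b) * a := by rw [mul_assoc _ _ a, ← h2, ← h1]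
    _ = (b * pinv b) * (a * pinv a) * a := by
      rw [InverseLaws.idem_comm _ _ (isIdem_mul_pinv a) (isIdem_mul_pinv b)]
    _ = b := by rw [mul_assoc, mul_pinv_mul, ← h2]

/-- The component of `χ` at `S a` is right translation by some `u`, and corestriction to the image
leaves `u` unchanged, so the product is `f ↦ f a u`. -/
theorem principal_mul (a : S) (χ : Cones (LeftIdeal S)) :
    principal a * χ = principal (a * val (χ.cone.app (ran a))) := by
  have hu := gen_mul_val (χ.cone.app (ran a))
  let p : (principal a).vertex ⟶ ran (val (χ.cone.app (ran a))) := toRan (χ.cone.app (ran a))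
  have : Epi p := epi_toRan (χ.cone.app (ran a))
  rw [Cones.mul_eq_star (principal a) χ p
    (ranIncl (χ.cone.app (ran a))) (ranIncl_isInclusion _) (toRan_ranIncl _).symm]
  set u := val (χ.cone.app (ran a))
  -- `a u` and `u` generate the same left ideal, since `a⁻¹ a u = u`.
  rw [principal_eq (a := a * u) (z := ran u)
    (pinv_mul_eq_of_mul (x := pinv a) (y := a) (by rw [← mul_assoc]; exact hu) rfl)]
  refine Cones.ext_eqToHom rfl fun f => hom_ext ?_
  rw [val_comp_eqToHom]
  exact mul_assoc f.gen a u

theorem principal_mul_principal (a b : S) : principal a * principal b = principal (a * b) := by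
  rw [principal_mul]
  change principal (a * ((ran a).gen * b)) = _
  rw [← mul_assoc, mul_gen_ran]

theorem isIdem_principalCone (e : LeftIdeal S) :
    (principalCone e.gen e (pinv_mul_self_of_isIdem e.idem)).IsIdem := by
  rw [ConeAt.IsIdem, ← principal_eq, IsIdempotentElem, principal_mul_principal, e.idem]

end LeftIdeal

open LeftIdeal

variable [InverseLaws S]

variable (S) in
/-- The connected category of an inverse semigroup. -/
abbrev leftIdealCat : ConnectedCat.{u} where
  carrier := LeftIdeal S
  down :=
    { carrier := {d | ∃ a : S, toAntisymmetrization (· ≤ ·) (principal a) = d}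
      lower' := by
        rintro _ d' h ⟨a, rfl⟩
        induction d' using Quotient.inductionOn with
        | _ γ =>
          -- A cone below `principal a` is a right multiple of it, hence principal.
          obtain ⟨χ, rfl⟩ := toAntisymmetrization_le_toAntisymmetrization_iff.1 h
          exact ⟨_, congrArg _ (principal_mul a χ).symm⟩ }
  connected e := ⟨⟨_, e.gen, rfl⟩, principalCone e.gen e (pinv_mul_self_of_isIdem e.idem),
    isIdem_principalCone e, by rw [rClass, ← principal_eq]⟩

theorem exists_principal_of_mem_down {γ : Cones (LeftIdeal S)}
    (h : toAntisymmetrization (· ≤ ·) γ ∈ (leftIdealCat S).down) : ∃ a : S, principal a = γ := by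
  obtain ⟨a, ha⟩ := h
  obtain ⟨χ, hχ⟩ := (Quotient.exact ha).2
  exact ⟨_, (principal_mul a χ).symm.trans hχ.symm⟩

/-- The cone is principal, say of `a`; since `principal` is an injective homomorphism `a` is
idempotent, and the vertex `S a` forces `a = e`. -/
theorem eq_principalCone {e : LeftIdeal S} {ε : ConeAt e} (hε : ε.IsIdem)
    (h : rClass ε ∈ (leftIdealCat S).down) :
    ε = principalCone e.gen e (pinv_mul_self_of_isIdem e.idem) := by
  obtain ⟨a, ha⟩ := exists_principal_of_mem_down h
  have hidem : IsIdempotentElem a := by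
    apply principal_injective
    rw [← principal_mul_principal, ha, hε.eq]
  have hv : ran a = e := congrArg Cones.vertex ha
  have hae : a = e.gen := by rw [← hv]; exact (pinv_mul_self_of_isIdem hidem).symm
  subst hae
  rw [principal_eq (pinv_mul_self_of_isIdem e.idem)] at ha
  simpa using ha.symm

theorem isSupported_leftIdealCat : IsSupported (leftIdealCat S) := by
  intro e
  obtain ⟨d, hd⟩ := (leftIdealCat S).connected e
  refine ⟨d, hd, fun d' hd' => Subtype.ext ?_⟩
  obtain ⟨ε, hε, hεd⟩ := hd
  obtain ⟨ε', hε', hεd'⟩ := hd'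
  rw [← hεd, ← hεd', eq_principalCone hε (by rw [hεd]; exact d.2),
    eq_principalCone hε' (by rw [hεd']; exact d'.2)]

theorem suppCone_leftIdealCat (e : LeftIdeal S) :
    suppCone (X := leftIdealCat S) isSupported_leftIdealCat e =
      principalCone e.gen e (pinv_mul_self_of_isIdem e.idem) :=
  eq_principalCone (suppCone_isIdem (X := leftIdealCat S) _ e)
    (rClass_suppCone_mem (X := leftIdealCat S) _ e)

theorem supportMap_leftIdealCat (e : LeftIdeal S) :
    (supportMap (X := leftIdealCat S) isSupported_leftIdealCat e).1 =
      toAntisymmetrization (· ≤ ·) (principal e.gen) := by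
  rw [← rClass_suppCone, suppCone_leftIdealCat, rClass, ← principal_eq]

theorem principal_le_iff {a b : S} : principal a ≤ principal b ↔ ∃ x, a = b * x := by
  constructor
  · rintro ⟨χ, hχ⟩
    rw [principal_mul] at hχ
    exact ⟨_, principal_injective hχ⟩
  · rintro ⟨x, rfl⟩
    exact ⟨principal x, (principal_mul_principal b x).symm⟩

/-- The left side means `e f = e`, the right side `e ∈ f S`, that is `f e = e`; they agree because
idempotents commute. -/
theorem supportMap_leftIdealCat_le_iff (e f : LeftIdeal S) :
    SubLE e f ↔ supportMap (X := leftIdealCat S) isSupported_leftIdealCat e ≤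
      supportMap (X := leftIdealCat S) isSupported_leftIdealCat f := by
  rw [← Subtype.coe_le_coe, supportMap_leftIdealCat, supportMap_leftIdealCat,
    toAntisymmetrization_le_toAntisymmetrization_iff, principal_le_iff, subLE_iff,
    InverseLaws.idem_comm _ _ e.idem f.idem]
  constructor
  · intro h
    exact ⟨e.gen, h.symm⟩
  · rintro ⟨x, hx⟩
    rw [hx, ← mul_assoc, f.idem]

theorem isSelfSupported_leftIdealCat : IsSelfSupported (leftIdealCat S) := by
  refine ⟨isSupported_leftIdealCat, ⟨?_, ?_⟩, supportMap_leftIdealCat_le_iff⟩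
  · intro e f h
    exact SubLE.antisymm ((supportMap_leftIdealCat_le_iff e f).2 h.le)
      ((supportMap_leftIdealCat_le_iff f e).2 h.ge)
  · rintro ⟨_, a, rfl⟩
    -- `a` and `a a⁻¹` generate the same right ideal.
    refine ⟨dom a, Subtype.ext ?_⟩
    rw [supportMap_leftIdealCat]
    refine Quotient.sound ⟨principal_le_iff.2 ⟨pinv a, rfl⟩, principal_le_iff.2 ⟨a, ?_⟩⟩
    exact (gen_dom_mul a).symm

end LeftIdeal

open LeftIdeal

/-! ### The functor from inverse semigroups to self-supported categories -/

section Map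

variable {S T : Type u} [Semigroup S] [Semigroup T]

/-- The functor between categories of left ideals induced by a homomorphism. -/
def leftIdealMap (φ : S →ₙ* T) : LeftIdeal S ⥤ LeftIdeal T where
  obj e := ⟨φ e.gen, e.idem.map φ⟩
  map {e f} a := mk' _ _ (φ (val a)) (by rw [← map_mul, gen_mul_val])
    (by rw [← map_mul, val_mul_gen])
  map_id _ := rfl
  map_comp a b := LeftIdeal.hom_ext (map_mul φ (val a) (val b))

theorem functor_ext_of_val {A : Type u} [SmallCategory A] {F G : A ⥤ LeftIdeal T}
    (h : ∀ {a b : A} (f : a ⟶ b), val (F.map f) = val (G.map f)) : F = G := by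
  have hobj : ∀ a, F.obj a = G.obj a := fun a => LeftIdeal.ext (by
    have := h (𝟙 a)
    rwa [F.map_id, G.map_id] at this)
  refine CategoryTheory.Functor.ext hobj fun a b f => LeftIdeal.hom_ext ?_
  rw [val_eqToHom_comp, val_comp_eqToHom, h]

/-- Makes any product a composite: the connecting morphism `f ⟶ g` is a component of the idempotent
cone at `g`, so morphisms of connected categories control its image. -/
theorem val_mul_val {e f g h : LeftIdeal S} (a : e ⟶ f) (b : g ⟶ h) :
    val a * val b = val (a ≫ mk' f g (f.gen * g.gen) (by rw [← mul_assoc, f.idem])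
      (by rw [mul_assoc, g.idem]) ≫ b) := by
  change _ = val a * (f.gen * g.gen * val b)
  rw [mul_assoc, gen_mul_val, ← mul_assoc, val_mul_gen]

variable [InverseLaws S] [InverseLaws T]

/-- The morphism of connected categories induced by a homomorphism of inverse semigroups. -/
noncomputable def leftIdealCCHom (φ : S →ₙ* T) : CCHom (leftIdealCat S) (leftIdealCat T) :=
  CCHom.ofFunctor isSelfSupported_leftIdealCat isSelfSupported_leftIdealCat (leftIdealMap φ)
    (fun j hj => congrArg φ hj)
    (fun c c' => LeftIdeal.hom_ext (by
      rw [suppCone_leftIdealCat, suppCone_leftIdealCat]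
      exact map_mul φ c'.gen c.gen))

variable (m : CCHom (leftIdealCat S) (leftIdealCat T))

theorem gen_obj_mul_gen_obj {e f : LeftIdeal S} (h : e.gen * f.gen = e.gen) :
    (m.functor.obj e).gen * (m.functor.obj f).gen = (m.functor.obj e).gen := by
  obtain ⟨j, hj⟩ := subLE_iff.2 h
  exact subLE_iff.1 ⟨_, m.map_incl j hj⟩

theorem val_map_mul {e f : LeftIdeal S} (b : f ⟶ e) (h : val b = f.gen * e.gen) :
    val (m.functor.map b) = (m.functor.obj f).gen * (m.functor.obj e).gen := by
  have h1 := CCHom.map_suppCone isSupported_leftIdealCat isSupported_leftIdealCat m e f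
  rw [suppCone_leftIdealCat, suppCone_leftIdealCat] at h1
  have hb : b = (principalCone e.gen e (pinv_mul_self_of_isIdem e.idem)).app f :=
    LeftIdeal.hom_ext h
  rw [hb, h1]
  rfl

/-- In the normal factorisation of `a` only the isomorphism matters: the retraction is a component
of an idempotent cone and the other factor an inclusion, so their images act as identities. -/
theorem val_map_isoOf {e f : LeftIdeal S} (a : e ⟶ f) :
    val (m.functor.map a) = val (m.functor.map (isoOf (val a)).hom) := by
  have ha : a = toDom a ≫ (isoOf (val a)).hom ≫ ranIncl a := LeftIdeal.hom_ext (by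
    change val a = (dom (val a)).gen * (val a * (ran (val a)).gen)
    rw [mul_gen_ran, gen_dom_mul])
  have hdom : val (m.functor.map (toDom a)) = (m.functor.obj (dom (val a))).gen := by
    have hcomm := InverseLaws.idem_comm _ _ e.idem (dom (val a)).idem
    rw [val_map_mul m (toDom a) (by rw [hcomm]; exact (gen_dom_val_mul a).symm),
      InverseLaws.idem_comm _ _ (m.functor.obj e).idem (m.functor.obj (dom (val a))).idem]
    exact gen_obj_mul_gen_obj m (gen_dom_val_mul a)
  have hran : val (m.functor.map (ranIncl a)) = (m.functor.obj (ran (val a))).gen :=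
    m.map_incl _ (ranIncl_isInclusion a)
  conv_lhs => rw [ha]
  rw [m.functor.map_comp, m.functor.map_comp, val_comp, val_comp, hdom, hran, val_mul_gen,
    gen_mul_val]

/-- The homomorphism induced by a morphism of connected categories. -/
noncomputable def mulHomOfCCHom : S →ₙ* T where
  toFun a := val (m.functor.map (isoOf a).hom)
  map_mul' a b := by
    have hc : val ((isoOf a).hom ≫ mk' (ran a) (dom b) ((ran a).gen * (dom b).gen)
        (by rw [← mul_assoc, (ran a).idem]) (by rw [mul_assoc, (dom b).idem]) ≫
          (isoOf b).hom) = a * b := (val_mul_val (isoOf a).hom (isoOf b).hom).symm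
    rw [← hc, ← val_map_isoOf, m.functor.map_comp, m.functor.map_comp, val_comp, val_comp,
      val_map_mul m (mk' (ran a) (dom b) _ _ _) rfl, mul_assoc _ _ (val _), gen_mul_val, ← mul_assoc, val_mul_gen]

theorem leftIdealCCHom_mulHomOfCCHom : leftIdealCCHom (mulHomOfCCHom m) = m :=
  CCHom.ext_functor isSelfSupported_leftIdealCat isSelfSupported_leftIdealCat
    (functor_ext_of_val fun a => (val_map_isoOf m a).symm)

theorem leftIdealCCHom_injective :
    Function.Injective (leftIdealCCHom : (S →ₙ* T) → CCHom (leftIdealCat S) (leftIdealCat T)) := by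
  intro φ ψ h
  have hF : leftIdealMap φ = leftIdealMap ψ := congrArg CCHom.functor h
  refine MulHom.ext fun a => ?_
  have key : ∀ {F G : LeftIdeal S ⥤ LeftIdeal T}, F = G →
      val (F.map (isoOf a).hom) = val (G.map (isoOf a).hom) := by
    rintro F _ rfl
    rfl
  exact key hF

end Map

instance (S : InverseSemigrp.{u}) : InverseLaws S.obj := ⟨S.property.1, S.property.2⟩

/-- The functor from inverse semigroups to self-supported categories. -/
noncomputable def leftIdealFunctor : InverseSemigrp.{u} ⥤ SelfSupportedCat.{u} where
  obj S := ⟨leftIdealCat S.obj, isSelfSupported_leftIdealCat⟩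
  map φ := ObjectProperty.homMk (leftIdealCCHom φ.hom.hom)
  map_id _ := ObjectProperty.hom_ext _
    (CCHom.ext_functor isSelfSupported_leftIdealCat isSelfSupported_leftIdealCat rfl)
  map_comp _ _ := ObjectProperty.hom_ext _
    (CCHom.ext_functor isSelfSupported_leftIdealCat isSelfSupported_leftIdealCat rfl)

instance : leftIdealFunctor.{u}.Faithful where
  map_injective {S T φ ψ} h := by
    refine ObjectProperty.hom_ext _ (Semigrp.hom_ext (leftIdealCCHom_injective ?_))
    exact congrArg (fun k => k.hom) h

instance : leftIdealFunctor.{u}.Full where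
  map_surjective {S T} m := by
    refine ⟨ObjectProperty.homMk (Semigrp.ofHom (mulHomOfCCHom m.hom)), ?_⟩
    exact ObjectProperty.hom_ext _ (leftIdealCCHom_mulHomOfCCHom m.hom)

/-! ### The inverse semigroup of a self-supported category -/

section UniqueInverses

variable {S : Type u} [Semigroup S]

/-- `a x` and `a y` are R-related idempotents, `x a` and `y a` are L-related ones; hence `x = x a x
= y a x = y a y = y`. -/
theorem inverse_unique_of_idem
    (hL : ∀ e f : S, IsIdempotentElem e → IsIdempotentElem f → e * f = e → f * e = f → e = f)
    (hR : ∀ e f : S, IsIdempotentElem e → IsIdempotentElem f → e * f = f → f * e = e → e = f)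
    {a x y : S} (hx : a * x * a = a) (hx' : x * a * x = x) (hy : a * y * a = a)
    (hy' : y * a * y = y) : x = y := by
  have h1 : a * x = a * y := hR _ _ (isIdem_mul_of_inv hx) (isIdem_mul_of_inv hy)
    (by rw [← mul_assoc, hx]) (by rw [← mul_assoc, hy])
  have h2 : x * a = y * a := hL _ _ (isIdem_mul_of_inv hx') (isIdem_mul_of_inv hy')
    (by rw [mul_assoc, ← mul_assoc a, hy]) (by rw [mul_assoc, ← mul_assoc a, hx])
  rw [← hx', h2, mul_assoc, h1, ← mul_assoc, hy']

theorem inverseLaws_of_idem (hreg : ∀ a : S, ∃ x, a * x * a = a)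
    (hL : ∀ e f : S, IsIdempotentElem e → IsIdempotentElem f → e * f = e → f * e = f → e = f)
    (hR : ∀ e f : S, IsIdempotentElem e → IsIdempotentElem f → e * f = f → f * e = e → e = f) :
    InverseLaws S := by
  have hinv : ∀ a : S, ∃ x : S, a * x * a = a ∧ x * a * x = x := by
    intro a
    obtain ⟨x, hx⟩ := hreg a
    refine ⟨x * a * x, ?_, ?_⟩
    · calc a * (x * a * x) * a = a * x * a * x * a := by simp only [mul_assoc]
        _ = a := by rw [hx, hx]
    · calc x * a * x * a * (x * a * x) = x * (a * x * a * x * a) * x := by simp only [mul_assoc]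
        _ = x * a * x := by rw [hx, hx]
  have hmul : ∀ e f : S, IsIdempotentElem e → IsIdempotentElem f → IsIdempotentElem (e * f) := by
    intro e f he hf
    obtain ⟨x, hx, hx'⟩ := hinv (e * f)
    -- With `x` an inverse of `e f`, the element `f x e` is idempotent, so its own inverse, but `e
    -- f` is an inverse of it too; uniqueness makes `e f` idempotent.
    have hg : IsIdempotentElem (f * x * e) := by
      calc f * x * e * (f * x * e) = f * (x * (e * f) * x) * e := by simp only [mul_assoc]
        _ = f * x * e := by rw [hx']
    have h1 : f * x * e * (e * f) * (f * x * e) = f * x * e := by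
      calc f * x * e * (e * f) * (f * x * e) = f * x * (e * e) * (f * f) * x * e := by
            simp only [mul_assoc]
        _ = f * (x * (e * f) * x) * e := by rw [he.eq, hf.eq]; simp only [mul_assoc]
        _ = f * x * e := by rw [hx']
    have h2 : e * f * (f * x * e) * (e * f) = e * f := by
      calc e * f * (f * x * e) * (e * f) = e * (f * f) * x * (e * e) * f := by
            simp only [mul_assoc]
        _ = e * f * x * (e * f) := by rw [he.eq, hf.eq]; simp only [mul_assoc]
        _ = e * f := hx
    have h3 : f * x * e = e * f :=
      inverse_unique_of_idem hL hR (a := f * x * e) (by rw [hg.eq, hg.eq])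
        (by rw [hg.eq, hg.eq]) h1 h2
    rw [← h3]
    exact hg
  have hcross : ∀ e f : S, IsIdempotentElem e → IsIdempotentElem f →
      e * f * (f * e) * (e * f) = e * f := by
    intro e f he hf
    calc e * f * (f * e) * (e * f) = e * (f * f) * (e * e) * f := by simp only [mul_assoc]
      _ = e * f * (e * f) := by rw [he.eq, hf.eq]; simp only [mul_assoc]
      _ = e * f := hmul e f he hf
  refine ⟨hinv, fun e f he hf => ?_⟩
  have h := hmul e f he hf
  -- Both `e f` and `f e` are inverses of the idempotent `e f`.
  exact inverse_unique_of_idem hL hR (a := e * f) (by rw [h.eq, h.eq]) (by rw [h.eq, h.eq])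
    (hcross e f he hf) (hcross f e hf he)

end UniqueInverses

/-! ### The semigroup cut out by the down-set, and its left ideals -/

section SupportSemigroup

/-- The semigroup of the cones whose `R`-class lies in the down-set of a connected category. -/
def supportSemigroup (X : ConnectedCat.{u}) : Subsemigroup (Cones X.carrier) where
  carrier := {γ | toAntisymmetrization (· ≤ ·) γ ∈ X.down}
  mul_mem' {γ δ} hγ _ := X.down.lower
    (toAntisymmetrization_le_toAntisymmetrization_iff.2 (Cones.mul_le γ δ)) hγ

variable {X : ConnectedCat.{u}}

theorem mem_supportSemigroup_of_le {γ δ : Cones X.carrier} (h : γ ≤ δ)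
    (hδ : δ ∈ supportSemigroup X) : γ ∈ supportSemigroup X :=
  X.down.lower (toAntisymmetrization_le_toAntisymmetrization_iff.2 h) hδ

/-- The idempotent with vertex `c` of the semigroup of a supported category. -/
noncomputable def suppIdem (hX : IsSupported X) (c : X.carrier) : supportSemigroup X :=
  ⟨⟨c, suppCone hX c⟩, rClass_suppCone_mem hX c⟩

theorem isIdem_suppIdem (hX : IsSupported X) (c : X.carrier) :
    IsIdempotentElem (suppIdem hX c) := Subtype.ext (suppCone_isIdem hX c)

theorem eq_suppIdem (hX : IsSupported X) {e : supportSemigroup X} (he : IsIdempotentElem e) :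
    e = suppIdem hX e.1.vertex :=
  Subtype.ext (congrArg (Cones.mk e.1.vertex)
    (eq_suppCone hX (ε := e.1.cone) (congrArg Subtype.val he) e.2))

theorem app_vertex_of_isIdem {e : supportSemigroup X} (he : IsIdempotentElem e) :
    e.1.cone.app e.1.vertex = 𝟙 _ :=
  ConeAt.IsIdem.app_vertex (ε := e.1.cone) (congrArg Subtype.val he)

theorem eq_of_vertex_eq (hX : IsSupported X) {e f : supportSemigroup X} (he : IsIdempotentElem e)
    (hf : IsIdempotentElem f) (h : e.1.vertex = f.1.vertex) : e = f := by
  rw [eq_suppIdem hX he, eq_suppIdem hX hf, h]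

theorem mul_eq_left_iff {e f : supportSemigroup X} (hf : IsIdempotentElem f) :
    e * f = e ↔ SubLE e.1.vertex f.1.vertex :=
  ⟨fun h => Cones.subLE_of_mul_eq (congrArg Subtype.val h),
    fun h => Subtype.ext (Cones.mul_eq_left_of_subLE e.1 f.1 (app_vertex_of_isIdem hf) h)⟩

theorem inverseLaws_supportSemigroup (hX : IsSelfSupported X) :
    InverseLaws (supportSemigroup X) := by
  have hs := hX.supported
  refine inverseLaws_of_idem ?_ ?_ ?_
  · rintro ⟨γ, hγ⟩
    obtain ⟨c, hc⟩ := hX.bijective.2 ⟨_, hγ⟩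
    have hr : rClass (suppCone hs c) = toAntisymmetrization (· ≤ ·) γ := by
      rw [rClass_suppCone, hc]
    obtain ⟨⟨χ, hχ⟩, hle⟩ := Quotient.exact hr
    have h1 : γ * (suppIdem hs γ.vertex).1 = γ :=
      Cones.mul_eq_left γ.cone (suppCone hs γ.vertex) (suppCone_isIdem hs _).app_vertex
    -- `χ` itself need not lie in the semigroup; multiplying it on the left by a right identity of
    -- `γ` that does puts it there and keeps `γ χ` the idempotent of the R-class of `γ`.
    refine ⟨⟨(suppIdem hs γ.vertex).1 * χ,
      mem_supportSemigroup_of_le (Cones.mul_le _ _) (suppIdem hs γ.vertex).2⟩, Subtype.ext ?_⟩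
    change γ * ((suppIdem hs γ.vertex).1 * χ) * γ = γ
    rw [← mul_assoc, h1, ← hχ]
    exact Cones.mul_eq_right_of_le (suppCone_isIdem hs c) hle
  · intro e f he hf h h'
    exact eq_of_vertex_eq hs he hf
      (SubLE.antisymm ((mul_eq_left_iff hf).1 h) ((mul_eq_left_iff he).1 h'))
  · intro e f he hf h h'
    refine eq_of_vertex_eq hs he hf (hX.bijective.1 (Subtype.ext ?_))
    have key : ∀ {e : supportSemigroup X}, IsIdempotentElem e →
        toAntisymmetrization (· ≤ ·) e.1 = (supportMap hs e.1.vertex).1 := by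
      intro e he
      exact rClass_eq_supportMap hs (ε := e.1.cone) (congrArg Subtype.val he) e.2
    rw [← key he, ← key hf]
    exact Quotient.sound
      ⟨⟨e.1, (congrArg Subtype.val h').symm⟩, ⟨f.1, (congrArg Subtype.val h).symm⟩⟩

/-! ### Comparison of a self-supported category with the category of its semigroup -/

/-- The vertex of the cone generating a left ideal. -/
abbrev vtx (e : LeftIdeal (supportSemigroup X)) : X.carrier := e.gen.1.vertex

theorem app_vtx (e : LeftIdeal (supportSemigroup X)) : e.gen.1.cone.app (vtx e) = 𝟙 (vtx e) :=
  app_vertex_of_isIdem e.idem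

theorem subLE_vtx {e f : LeftIdeal (supportSemigroup X)} (a : e ⟶ f) :
    SubLE (val a).1.vertex (vtx f) :=
  (mul_eq_left_iff f.idem).1 (val_mul_gen a)

/-- The inclusion of the vertex of a cone defining a morphism. -/
noncomputable def vtxIncl {e f : LeftIdeal (supportSemigroup X)} (a : e ⟶ f) :
    (val a).1.vertex ⟶ vtx f := (subLE_vtx a).choose

theorem vtxIncl_isInclusion {e f : LeftIdeal (supportSemigroup X)} (a : e ⟶ f) :
    IsInclusion (vtxIncl a) := (subLE_vtx a).choose_spec

theorem epi_app_vtx {e f : LeftIdeal (supportSemigroup X)} (a : e ⟶ f) :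
    Epi ((val a).1.cone.app (vtx e)) :=
  (Cones.app_eq_of_mul_eq (app_vtx e) (congrArg Subtype.val (gen_mul_val a))).1

theorem app_eq_app_vtx {e f : LeftIdeal (supportSemigroup X)} (a : e ⟶ f) (c : X.carrier) :
    (val a).1.cone.app c = e.gen.1.cone.app c ≫ (val a).1.cone.app (vtx e) :=
  (Cones.app_eq_of_mul_eq (app_vtx e) (congrArg Subtype.val (gen_mul_val a))).2 c

/-- The component at the vertex of `e` of the cone defining a morphism `e ⟶ f`, followed by the
inclusion into the vertex of `f`. -/
noncomputable def vtxMap {e f : LeftIdeal (supportSemigroup X)} (a : e ⟶ f) : vtx e ⟶ vtx f :=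
  (val a).1.cone.app (vtx e) ≫ vtxIncl a

theorem vtxMap_eq {e f : LeftIdeal (supportSemigroup X)} (a : e ⟶ f)
    (j : (val a).1.vertex ⟶ vtx f) (hj : IsInclusion j) :
    vtxMap a = (val a).1.cone.app (vtx e) ≫ j := by
  rw [vtxMap, CategoryWithSubobjects.incl_unique _ _ (vtxIncl_isInclusion a) hj]

theorem vtxMap_of_val_eq {e f : LeftIdeal (supportSemigroup X)} (a : e ⟶ f)
    (h : val a = e.gen) : IsInclusion (vtxMap a) := by
  have : ∀ (γ : supportSemigroup X), γ = e.gen → ∀ j : γ.1.vertex ⟶ vtx f, IsInclusion j →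
      IsInclusion (γ.1.cone.app (vtx e) ≫ j) := by
    rintro _ rfl j hj
    rw [app_vtx]
    exact CategoryWithSubobjects.comp_incl _ _ (CategoryWithSubobjects.id_incl _) hj
  exact this _ h _ (vtxIncl_isInclusion a)

theorem vtxMap_comp {e f g : LeftIdeal (supportSemigroup X)} (a : e ⟶ f) (b : f ⟶ g) :
    vtxMap (a ≫ b) = vtxMap a ≫ vtxMap b := by
  let j : (val (a ≫ b)).1.vertex ⟶ vtx g :=
    inclPart ((val b).1.cone.app (val a).1.vertex) ≫ vtxIncl b
  rw [vtxMap_eq (a ≫ b) j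
    (CategoryWithSubobjects.comp_incl _ _ (inclPart_incl _) (vtxIncl_isInclusion b))]
  change ((val a).1.cone.app (vtx e) ≫ epiPart ((val b).1.cone.app (val a).1.vertex)) ≫
    inclPart ((val b).1.cone.app (val a).1.vertex) ≫ vtxIncl b = _
  -- The component of `b` at the vertex of `a` is the inclusion into `vtx f` followed by the
  -- component of `b` there.
  rw [Category.assoc, ← Category.assoc (epiPart _), epiPart_inclPart, vtxMap, vtxMap,
    ← (val b).1.cone.incl_app _ (vtxIncl_isInclusion a)]
  simp only [Category.assoc]

variable (X) in
/-- The functor that sends a left ideal generated by an idempotent cone to the vertex of the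
cone. -/
noncomputable def vtxFunctor : LeftIdeal (supportSemigroup X) ⥤ X.carrier where
  obj := vtx
  map := vtxMap
  map_id e := CategoryWithSubobjects.incl_unique _ _ (vtxMap_of_val_eq (𝟙 e) rfl)
    (CategoryWithSubobjects.id_incl _)
  map_comp := vtxMap_comp

/-- Uniqueness of the canonical factorisation recovers the component at `vtx e` from `vtxMap a`, and
that component determines the cone. -/
instance : (vtxFunctor X).Faithful where
  map_injective {e f a b} h := by
    have h' : vtxMap a = vtxMap b := h
    have ha := epi_app_vtx a
    have hb := epi_app_vtx b
    obtain ⟨k, hk⟩ := canonical_unique _ _ _ _ (vtxIncl_isInclusion a) (vtxIncl_isInclusion b) h'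
    refine LeftIdeal.hom_ext (Subtype.ext (Cones.ext_eqToHom k fun c => ?_))
    rw [app_eq_app_vtx a, app_eq_app_vtx b, Category.assoc, hk]

/-- The cone defining a given morphism between vertices. -/
noncomputable def conesOfHom (e : LeftIdeal (supportSemigroup X)) {y : X.carrier}
    (g : vtx e ⟶ y) : Cones X.carrier := ⟨im g, e.gen.1.cone.star (epiPart g)⟩

theorem gen_mul_conesOfHom (e : LeftIdeal (supportSemigroup X)) {y : X.carrier} (g : vtx e ⟶ y) :
    e.gen.1 * conesOfHom e g = conesOfHom e g := by
  refine Cones.mul_eq_star e.gen.1 (conesOfHom e g) (epiPart g : e.gen.1.vertex ⟶ im g) (𝟙 _)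
    (CategoryWithSubobjects.id_incl _) ?_
  change e.gen.1.cone.app (vtx e) ≫ epiPart g = epiPart g ≫ 𝟙 _
  rw [app_vtx, Category.id_comp, Category.comp_id]

instance : (vtxFunctor X).Full where
  map_surjective {e f} g := by
    change vtx e ⟶ vtx f at g
    have hmem : conesOfHom e g ∈ supportSemigroup X :=
      mem_supportSemigroup_of_le ⟨_, (gen_mul_conesOfHom e g).symm⟩ e.gen.2
    have hright : (⟨conesOfHom e g, hmem⟩ : supportSemigroup X) * f.gen = ⟨_, hmem⟩ :=
      (mul_eq_left_iff f.idem).2 ⟨inclPart g, inclPart_incl g⟩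
    refine ⟨mk' e f ⟨conesOfHom e g, hmem⟩ (Subtype.ext (gen_mul_conesOfHom e g)) hright, ?_⟩
    refine (vtxMap_eq _ (inclPart g) (inclPart_incl g)).trans ?_
    change (e.gen.1.cone.app (vtx e) ≫ epiPart g) ≫ inclPart g = g
    rw [app_vtx, Category.id_comp, epiPart_inclPart]

theorem vtxFunctor_obj_bijective (hX : IsSupported X) :
    Function.Bijective (vtxFunctor X).obj :=
  ⟨fun e f h => LeftIdeal.ext (eq_of_vertex_eq hX e.idem f.idem h),
    fun c => ⟨⟨suppIdem hX c, isIdem_suppIdem hX c⟩, rfl⟩⟩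

variable [InverseLaws (supportSemigroup X)]

theorem isInclusion_vtxFunctor_map_iff {e f : LeftIdeal (supportSemigroup X)} (a : e ⟶ f) :
    IsInclusion ((vtxFunctor X).map a) ↔ IsInclusion a := by
  refine ⟨fun h => ?_, fun h => vtxMap_of_val_eq a h⟩
  obtain ⟨j, hj⟩ := LeftIdeal.subLE_iff.2 ((mul_eq_left_iff (e := e.gen) f.idem).2 ⟨_, h⟩)
  have : a = j := (vtxFunctor X).map_injective
    (CategoryWithSubobjects.incl_unique _ _ h (vtxMap_of_val_eq j hj))
  rw [this]
  exact hj

/-- The component at `f` is carried by the product `f e`, whose component at `vtx f` is the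
epimorphic part of that of `e`; the inclusion restores the rest. -/
theorem vtxFunctor_map_suppCone (hX : IsSupported X) (e f : LeftIdeal (supportSemigroup X)) :
    (vtxFunctor X).map ((suppCone (X := leftIdealCat (supportSemigroup X))
      isSupported_leftIdealCat e).app f) =
        (suppCone hX ((vtxFunctor X).obj e)).app ((vtxFunctor X).obj f) := by
  rw [suppCone_leftIdealCat]
  refine (vtxMap_eq _ (inclPart (e.gen.1.cone.app f.gen.1.vertex)) (inclPart_incl _)).trans ?_
  change (f.gen.1.cone.app (vtx f) ≫ epiPart (e.gen.1.cone.app f.gen.1.vertex)) ≫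
    inclPart (e.gen.1.cone.app f.gen.1.vertex) = _
  rw [app_vtx, Category.id_comp, epiPart_inclPart]
  change _ = (suppCone hX e.gen.1.vertex).app f.gen.1.vertex
  rw [← eq_suppCone hX (ε := e.gen.1.cone) (congrArg Subtype.val e.idem) e.gen.2]

end SupportSemigroup

/-! ### Essential surjectivity and the equivalence -/

instance : leftIdealFunctor.{u}.EssSurj where
  mem_essImage X := by
    have hinv := inverseLaws_supportSemigroup X.property
    let S : InverseSemigrp.{u} :=
      ⟨Semigrp.of (supportSemigroup X.obj), hinv.exists_inv, hinv.idem_comm⟩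
    have hfull : (vtxFunctor X.obj).Full := inferInstance
    have hfaithful : (vtxFunctor X.obj).Faithful := inferInstance
    exact ⟨S, @nonempty_iso_of_functor (leftIdealFunctor.obj S) X (vtxFunctor X.obj) hfull hfaithful
      (vtxFunctor_obj_bijective X.property.supported) isInclusion_vtxFunctor_map_iff
      (vtxFunctor_map_suppCone X.property.supported)⟩

end ConeSemigroups

theorem theorem6 :
    Nonempty (ConeSemigroups.InverseSemigrp.{u} ≌ ConeSemigroups.SelfSupportedCat.{u}) := by
  have : ConeSemigroups.leftIdealFunctor.{u}.IsEquivalence := { }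
  exact ⟨ConeSemigroups.leftIdealFunctor.asEquivalence⟩
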